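/- Let $n\ge 2$ be an integer. Equip $\mathbb R^n$ with the Euclidean norm $\|\cdot\|$ and the torus $\mathbb T^n=\mathbb R^n/\mathbb Z^n$ with the induced quotient (flat) distance. For $\tau>n-1$, $\gamma>0$ and $N\ge 1$ let $$\mathcal D^1_n(\tau,\gamma)=\{\alpha\in\mathbb R^n:\ \|\alpha\|=1,\ |k\cdot\alpha|\ge\gamma\|k\|^{-\tau}\text{ for all }k\in\mathbb Z^n\setminus\{0\}\},$$ $$\mathcal D^1_n(\tau,\gamma,N)=\{\alpha\in\mathbb R^n:\ \|\alpha\|=1,\ |k\cdot\alpha|\ge\gamma\|k\|^{-\tau}\text{ for all }k\in\mathbb Z^n\text{ with }0<\|k\|\le N\}.$$ For $\alpha\in\mathbb R^n$, $\delta\in(0,\tfrac12)$ and $T\ge 0$, the linear flow $\alpha_t(\theta)=\theta+t\alpha$ is said to fill $\mathbb T^n$ to within $\delta$ after time $T$ if, for every starting point $\theta\in\mathbb T^n$, every closed ball of radius $\delta$ in $\mathbb T^n$ contains a point of the orbit segment $\{\alpha_t(\theta):0\le t\le T\}$. Corollary 2. Let $n\ge2$ be an integer and let $\tau>n-1$ and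 $\gamma\in(0,1)$ be real numbers such that $\mathcal D^1_n(\tau,\gamma)$ is nonempty. Then for every $\delta\in(0,\tfrac12)$, every real cutoff $N\ge N^*=(1+n^2\,n!)/\delta$ and every $\alpha\in\mathcal D^1_n(\tau,\gamma,N)$, the flow $\alpha_t$ fills $\mathbb T^n$ to within $\delta$ after some time $T$ with $$0\le T<\frac{(1+n^2\,n!)^{\tau+1}}{\gamma\,\delta^{\tau}}.$$ -/

import Mathlib

namespace TorusFilling

/-- The integer lattice `ℤⁿ`, as an additive subgroup of Euclidean space `ℝⁿ`. -/
def intLattice (n : ℕ) : AddSubgroup (EuclideanSpace ℝ (Fin n)) where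
  carrier := {x | ∀ i, ∃ m : ℤ, x i = (m : ℝ)}
  zero_mem' := fun _ => ⟨0, by simp⟩
  add_mem' := by
    intro x y hx hy i
    obtain ⟨a, ha⟩ := hx i
    obtain ⟨b, hb⟩ := hy i
    exact ⟨a + b, by simp [ha, hb]⟩
  neg_mem' := by
    intro x hx i
    obtain ⟨a, ha⟩ := hx i
    exact ⟨-a, by simp [ha]⟩

/-- The flat torus `𝕋ⁿ = ℝⁿ / ℤⁿ`. Its distance is Mathlib's quotient distance: the distance between
two classes is the infimum of the Euclidean distances between representatives. -/
abbrev Torus (n : ℕ) : Type := EuclideanSpace ℝ (Fin n) ⧸ intLattice n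

/-- The Diophantine vectors `𝒟ₙ(τ, γ)`. -/
def diophantine (n : ℕ) (τ γ : ℝ) : Set (EuclideanSpace ℝ (Fin n)) :=
  {α | ∀ k ∈ intLattice n, k ≠ 0 → γ * ‖k‖ ^ (-τ) ≤ |inner ℝ k α|}

/-- The truncated Diophantine vectors `𝒟ₙ(τ, γ, N)`; the cutoff `N` is a real number. -/
def truncDiophantine (n : ℕ) (τ γ N : ℝ) : Set (EuclideanSpace ℝ (Fin n)) :=
  {α | ∀ k ∈ intLattice n, 0 < ‖k‖ → ‖k‖ ≤ N → γ * ‖k‖ ^ (-τ) ≤ |inner ℝ k α|}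

/-- The Diophantine vectors of unit length, `𝒟¹ₙ(τ, γ)`. -/
def unitDiophantine (n : ℕ) (τ γ : ℝ) : Set (EuclideanSpace ℝ (Fin n)) :=
  Metric.sphere 0 1 ∩ diophantine n τ γ

/-- The truncated Diophantine vectors of unit length, `𝒟¹ₙ(τ, γ, N)`. -/
def unitTruncDiophantine (n : ℕ) (τ γ N : ℝ) : Set (EuclideanSpace ℝ (Fin n)) :=
  Metric.sphere 0 1 ∩ truncDiophantine n τ γ N

/-- The linear flow `α_t(θ) = θ + t α` on the torus. -/
def linearFlow {n : ℕ} (α : EuclideanSpace ℝ (Fin n)) (t : ℝ) (θ : Torus n) : Torus n :=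
  θ + QuotientAddGroup.mk (t • α)

/-- The flow in direction `α` fills the torus to within `δ` after time `T`: for every starting
point `θ`, every closed ball of radius `δ` contains a point of the orbit segment
`{α_t(θ) : 0 ≤ t ≤ T}`. -/
def Fills {n : ℕ} (α : EuclideanSpace ℝ (Fin n)) (δ T : ℝ) : Prop :=
  ∀ θ c : Torus n, ∃ t ∈ Set.Icc (0 : ℝ) T, linearFlow α t θ ∈ Metric.closedBall c δ

end TorusFilling

/-! The proof turns filling into a covering problem for a lattice and solves that by transference.

Let `A` scale the line of `α` by a small `a` and its orthogonal complement by a large `b`. If every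
point lies within `n ^ 2 / 2` of `A ℤⁿ`, undoing the scaling shows that every displacement is,
modulo `ℤⁿ`, a multiple of `α` of size at most `n ^ 2 / (2 * a)` plus an orthogonal error of at most
`n ^ 2 / (2 * b)`. That is filling.

The covering bound holds once the dual lattice has no nonzero vector shorter than 1
(`AddSubgroup.exists_norm_sub_le_of_forall_dual`). As `A` is symmetric, it maps a dual vector of `A
ℤⁿ` to an integer vector. A short one would give a bounded `k` with `k · α` too small, which the
truncated Diophantine condition forbids. -/

/-! ### Geometry of numbers: short vectors and covering radius -/

open MeasureTheory Module Submodule in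
-- Minkowski's linear forms theorem: the preimage of the cube is convex, symmetric and compact, of
-- volume `(2 * s) ^ n / |det M| ≥ 2 ^ n`. Compactness allows equality.
theorem Matrix.exists_int_ne_zero_forall_abs_mulVec_le {n : ℕ} (hn : 0 < n)
    (M : Matrix (Fin n) (Fin n) ℝ) (hM : M.det ≠ 0) {s : ℝ} (hs : 0 ≤ s) (h : |M.det| ≤ s ^ n) :
    ∃ k : Fin n → ℤ, k ≠ 0 ∧ ∀ i, |M.mulVec (fun j => (k j : ℝ)) i| ≤ s := by
  have : Nonempty (Fin n) := ⟨⟨0, hn⟩⟩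
  let b := Pi.basisFun ℝ (Fin n)
  let S : Set (Fin n → ℝ) := Matrix.toLin' M ⁻¹' Set.Icc (fun _ => -s) (fun _ => s)
  have hmem : ∀ x, x ∈ S ↔ ∀ i, |M.mulVec x i| ≤ s := by
    intro x
    simp only [S, Set.mem_preimage, Set.mem_Icc, Pi.le_def, Matrix.toLin'_apply, abs_le,
      ← forall_and]
  have hdet : LinearMap.det (Matrix.toLin' M) ≠ 0 := by rwa [LinearMap.det_toLin']
  have hcpt : IsCompact S := by
    let e := (LinearMap.equivOfDetNeZero _ hdet).toContinuousLinearEquiv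
    exact e.toHomeomorph.isCompact_preimage.2 isCompact_Icc
  have hconv : Convex ℝ S := (convex_Icc _ _).linear_preimage _
  have hsymm : ∀ x ∈ S, -x ∈ S := by
    intro x hx
    rw [hmem] at hx ⊢
    simpa [Matrix.mulVec_neg] using hx
  have hvol : volume (ZSpan.fundamentalDomain b) * 2 ^ finrank ℝ (Fin n → ℝ) ≤ volume S := by
    rw [ZSpan.fundamentalDomain_pi_basisFun, Measure.addHaar_preimage_linearMap _ hdet,
      LinearMap.det_toLin', Real.volume_Icc_pi, Real.volume_pi_Ico]
    simp only [sub_zero, ENNReal.ofReal_one, Finset.prod_const_one, one_mul, finrank_pi,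
      Finset.prod_const, Finset.card_univ, Fintype.card_fin, sub_neg_eq_add]
    rw [← ENNReal.ofReal_pow (by positivity), ← ENNReal.ofReal_mul (by positivity),
      show (2 : ENNReal) ^ n = ENNReal.ofReal (2 ^ n) by
        rw [ENNReal.ofReal_pow (by norm_num)]; norm_num]
    apply ENNReal.ofReal_le_ofReal
    rw [abs_inv, ← two_mul, mul_pow, inv_mul_eq_div, le_div_iff₀ (abs_pos.2 hM)]
    gcongr
  have : Countable (span ℤ (Set.range b)).toAddSubgroup :=
    inferInstanceAs (Countable (span ℤ (Set.range b)))
  have : DiscreteTopology (span ℤ (Set.range b)).toAddSubgroup :=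
    inferInstanceAs (DiscreteTopology (span ℤ (Set.range b)))
  obtain ⟨x, hx0, hx⟩ := exists_ne_zero_mem_lattice_of_measure_mul_two_pow_le_measure
    (ZSpan.isAddFundamentalDomain' b volume) hsymm hconv hcpt hvol
  have hx' := x.2
  rw [Submodule.mem_toAddSubgroup, Basis.mem_span_iff_repr_mem] at hx'
  choose k hk using hx'
  have hxk : (x : Fin n → ℝ) = fun j => (k j : ℝ) := by
    ext j
    simpa [b] using (hk j).symm
  refine ⟨k, ?_, ?_⟩
  · rintro rfl
    exact hx0 (Subtype.ext (hxk.trans (by ext; simp)))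
  · rw [← hxk]
    exact (hmem _).1 hx

open Module in
-- Minkowski is applied to the lattice and to its dual, whose determinants are inverse to each
-- other. The bound from below on dual vectors limits the determinant, hence the short vector.
theorem Module.Basis.exists_norm_le_of_forall_dual {n : ℕ} (hn : 0 < n) {E : Type*}
    [NormedAddCommGroup E] [InnerProductSpace ℝ E] (b : Basis (Fin n) ℝ E)
    (hdual : ∀ y : E, y ≠ 0 → (∀ j, ∃ m : ℤ, inner ℝ (b j) y = m) → 1 ≤ ‖y‖) :
    ∃ k : Fin n → ℤ, k ≠ 0 ∧ ‖∑ j, (k j : ℝ) • b j‖ ≤ n := by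
  have : FiniteDimensional ℝ E := b.finiteDimensional_of_finite
  have hfr : finrank ℝ E = n := by simpa using finrank_eq_card_basis b
  let e : OrthonormalBasis (Fin n) ℝ E := (stdOrthonormalBasis ℝ E).reindex (finCongr hfr)
  let M : Matrix (Fin n) (Fin n) ℝ := e.toBasis.toMatrix b
  have hMapply : ∀ i j, M i j = inner ℝ (e i) (b j) := by
    intro i j
    simp [M, Basis.toMatrix_apply, OrthonormalBasis.repr_apply_apply]
  have hunit : IsUnit M.det := by
    rw [← Matrix.isUnit_iff_isUnit_det]
    have := e.toBasis.invertibleToMatrix b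
    exact isUnit_of_invertible M
  have hdet : M.det ≠ 0 := hunit.ne_zero
  have hpos : 0 < |M.det| := abs_pos.2 hdet
  have hn' : (n : ℝ) ≠ 0 := by positivity
  let s : ℝ := |M.det| ^ ((n : ℝ)⁻¹)
  have hs : 0 < s := by positivity
  have hsn : s ^ n = |M.det| := Real.rpow_inv_natCast_pow hpos.le hn.ne'
  have hnorm : ∀ (v : Fin n → ℝ) (r : ℝ), (∀ i, |v i| ≤ r) →
      ‖∑ i, v i • e i‖ ^ 2 ≤ n * r ^ 2 := by
    intro v r hv
    have h1 : ‖∑ i, v i • e i‖ ^ 2 = ∑ i, v i ^ 2 := by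
      rw [← e.sum_sq_norm_inner_right]
      refine Finset.sum_congr rfl fun i _ => ?_
      rw [e.orthonormal.inner_right_fintype, Real.norm_eq_abs, sq_abs]
    rw [h1]
    calc ∑ i, v i ^ 2 ≤ ∑ _i : Fin n, r ^ 2 :=
          Finset.sum_le_sum fun i _ => by rw [← sq_abs]; gcongr; exact hv i
      _ = n * r ^ 2 := by simp
  obtain ⟨k, hk0, hk⟩ := M.exists_int_ne_zero_forall_abs_mulVec_le hn hdet hs.le hsn.ge
  -- The columns of the inverse transpose are the dual basis in the coordinates of `e`.
  obtain ⟨l, hl0, hl⟩ := (M⁻¹.transpose).exists_int_ne_zero_forall_abs_mulVec_le hn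
    (by rw [Matrix.det_transpose, Matrix.det_nonsing_inv]; simpa using hdet)
    (inv_nonneg.2 hs.le)
    (by rw [Matrix.det_transpose, Matrix.det_nonsing_inv, Ring.inverse_eq_inv', abs_inv, inv_pow,
      hsn])
  refine ⟨k, hk0, ?_⟩
  have hu : ∑ j, (k j : ℝ) • b j = ∑ i, M.mulVec (fun j => (k j : ℝ)) i • e i := by
    rw [← e.sum_repr' (∑ j, (k j : ℝ) • b j)]
    refine Finset.sum_congr rfl fun i _ => ?_
    rw [inner_sum]
    congr 1
    simp [Matrix.mulVec, dotProduct, hMapply, inner_smul_right, mul_comm]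
  have hunorm := hnorm _ _ hk
  rw [← hu] at hunorm
  set w := M⁻¹.transpose.mulVec (fun j => (l j : ℝ)) with hw
  have hwl : M.transpose.mulVec w = fun j => (l j : ℝ) := by
    rw [hw, Matrix.mulVec_mulVec, ← Matrix.transpose_mul, Matrix.nonsing_inv_mul _ hunit,
      Matrix.transpose_one, Matrix.one_mulVec]
  have hinner : ∀ j, inner ℝ (b j) (∑ i, w i • e i) = (l j : ℝ) := by
    intro j
    rw [← congrFun hwl j, inner_sum]
    simp [Matrix.mulVec, dotProduct, hMapply, inner_smul_right, mul_comm, real_inner_comm]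
  have hy := hdual (∑ i, w i • e i) (by
    intro h0
    apply hl0
    ext j
    have := hinner j
    rw [h0, inner_zero_right] at this
    exact_mod_cast this.symm) (fun j => ⟨l j, hinner j⟩)
  have hynorm := hnorm _ _ hl
  have h1 : (1 : ℝ) ≤ n * s⁻¹ ^ 2 := by
    refine le_trans ?_ hynorm
    nlinarith
  have h2 : s ^ 2 ≤ n := by
    rw [inv_pow, ← div_eq_mul_inv, le_div_iff₀ (by positivity)] at h1
    linarith
  have h3 : ‖∑ j, (k j : ℝ) • b j‖ ^ 2 ≤ (n : ℝ) ^ 2 := by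
    refine hunorm.trans ?_
    rw [sq (n : ℝ)]
    gcongr
  exact (sq_le_sq₀ (norm_nonneg _) (by positivity)).1 h3

open Module in
theorem AddSubgroup.exists_ne_zero_norm_le_of_forall_dual {E : Type*}
    [NormedAddCommGroup E] [InnerProductSpace ℝ E] [FiniteDimensional ℝ E] (hE : 0 < finrank ℝ E)
    (L : AddSubgroup E) (hL : Submodule.span ℝ (L : Set E) = ⊤)
    (hdual : ∀ y : E, y ≠ 0 → (∀ x ∈ L, ∃ m : ℤ, inner ℝ x y = m) → 1 ≤ ‖y‖) :
    ∃ u ∈ L, u ≠ 0 ∧ ‖u‖ ≤ finrank ℝ E := by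
  by_contra! hcon
  let Λ : Submodule ℤ E := L.toIntSubmodule
  -- The negated conclusion separates nonzero vectors from 0, so `L` is a genuine lattice and has a
  -- basis.
  have hdisc : DiscreteTopology Λ := by
    refine DiscreteTopology.of_forall_le_norm (r := finrank ℝ E) (by exact_mod_cast hE) ?_
    intro x hx
    exact (hcon x x.2 (by simpa using hx)).le
  have : IsZLattice ℝ Λ := ⟨hL⟩
  have : Module.Finite ℤ Λ := ZLattice.module_finite ℝ Λ
  have : Module.Free ℤ Λ := ZLattice.module_free ℝ Λ
  let b₀ : Basis (Fin (finrank ℝ E)) ℤ Λ := finBasisOfFinrankEq ℤ Λ (ZLattice.rank ℝ Λ)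
  let b : Basis (Fin (finrank ℝ E)) ℝ E := b₀.ofZLatticeBasis ℝ Λ
  have hspan : Submodule.span ℤ (Set.range b) = Λ := b₀.ofZLatticeBasis_span ℝ
  obtain ⟨k, hk0, hk⟩ := b.exists_norm_le_of_forall_dual hE (by
    intro y hy hint
    refine hdual y hy fun x hx => ?_
    have hx' : x ∈ Submodule.span ℤ (Set.range b) := by rw [hspan]; exact hx
    induction hx' using Submodule.span_induction with
    | mem x h => obtain ⟨j, rfl⟩ := h; exact hint j
    | zero => exact ⟨0, by simp⟩
    | add x z h1 h2 ihx ihz =>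
      obtain ⟨p, hp⟩ := ihx (by rw [hspan] at h1; exact h1)
      obtain ⟨q, hq⟩ := ihz (by rw [hspan] at h2; exact h2)
      exact ⟨p + q, by rw [inner_add_left, hp, hq]; push_cast; rfl⟩
    | smul a x h1 ihx =>
      obtain ⟨p, hp⟩ := ihx (by rw [hspan] at h1; exact h1)
      exact ⟨a * p, by rw [← Int.cast_smul_eq_zsmul ℝ, real_inner_smul_left, hp]; push_cast; rfl⟩)
  refine absurd hk (not_le.2 (hcon _ ?_ ?_))
  · refine sum_mem fun j _ => ?_
    rw [Int.cast_smul_eq_zsmul]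
    refine zsmul_mem ?_ _
    have : b j ∈ Λ := hspan ▸ Submodule.subset_span ⟨j, rfl⟩
    exact this
  · intro h0
    apply hk0
    ext j
    exact_mod_cast Fintype.linearIndependent_iff.1 b.linearIndependent _ h0 j

open Module in
-- Induction on dimension: project along a short vector `u`, cover in the hyperplane, then correct
-- the `u`-component by rounding. The dual hypothesis survives, since a dual vector of the
-- projection is also one of `L`.
theorem AddSubgroup.exists_norm_sub_le_of_forall_dual (n : ℕ) {E : Type*}
    [NormedAddCommGroup E] [InnerProductSpace ℝ E] [FiniteDimensional ℝ E] (hE : finrank ℝ E = n)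
    (L : AddSubgroup E) (hL : Submodule.span ℝ (L : Set E) = ⊤)
    (hdual : ∀ y : E, y ≠ 0 → (∀ x ∈ L, ∃ m : ℤ, inner ℝ x y = m) → 1 ≤ ‖y‖) (x : E) :
    ∃ l ∈ L, ‖x - l‖ ≤ (n : ℝ) ^ 2 / 2 := by
  induction n generalizing E with
  | zero =>
    have := finrank_zero_iff.1 hE
    exact ⟨0, zero_mem _, by simp [Subsingleton.elim x 0]⟩
  | succ n ih =>
    obtain ⟨u, huL, hu0, hu⟩ := L.exists_ne_zero_norm_le_of_forall_dual (by omega) hL hdual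
    let F : Submodule ℝ E := (ℝ ∙ u)ᗮ
    let P : E →L[ℝ] F := F.orthogonalProjectionOnto
    have : Fact (finrank ℝ E = n + 1) := ⟨hE⟩
    obtain ⟨l', hl', hd⟩ := ih (E := F) (Submodule.finrank_orthogonal_span_singleton hu0)
      (L.map (P : E →ₗ[ℝ] F).toAddMonoidHom) (by
        have h1 : ((L.map (P : E →ₗ[ℝ] F).toAddMonoidHom : AddSubgroup F) : Set F)
          = (P : E →ₗ[ℝ] F) '' L := rfl
        rw [h1, Submodule.span_image, hL, Submodule.map_top, LinearMap.range_eq_top]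
        intro z
        exact ⟨z, F.orthogonalProjectionOnto_mem_subspace_eq_self z⟩) (by
        intro y hy hint
        have := hdual (y : E) (by simpa using hy) (by
          intro z hz
          obtain ⟨m, hm⟩ := hint (P z) ⟨z, hz, rfl⟩
          refine ⟨m, ?_⟩
          rw [← hm, Submodule.coe_inner]
          exact (F.inner_orthogonalProjectionOnto_eq_of_mem_right y z).symm)
        exact this) (P x)
    obtain ⟨l, hl, rfl⟩ := hl'
    have hmem : (x - l) - P (x - l) ∈ ℝ ∙ u := by
      have := F.sub_starProjection_mem_orthogonal (x - l)
      rwa [Submodule.orthogonal_orthogonal] at this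
    obtain ⟨c, hc⟩ := Submodule.mem_span_singleton.1 hmem
    refine ⟨l + round c • u, add_mem hl (zsmul_mem huL _), ?_⟩
    have heq : x - (l + round c • u) = (P (x - l) : E) + (c - round c) • u := by
      rw [sub_smul, hc, Int.cast_smul_eq_zsmul]
      abel
    have hPd : ‖(P (x - l) : E)‖ ≤ (n : ℝ) ^ 2 / 2 := by
      rw [map_sub]
      exact hd
    rw [heq]
    calc _ ≤ ‖(P (x - l) : E)‖ + ‖(c - round c) • u‖ := norm_add_le _ _
      _ ≤ (n : ℝ) ^ 2 / 2 + 1 / 2 * (n + 1) := by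
        refine add_le_add hPd ?_
        rw [norm_smul]
        rw [hE] at hu
        push_cast at hu
        gcongr
        exact abs_sub_round c
      -- `n ^ 2 + (n + 1) ≤ (n + 1) ^ 2`.
      _ ≤ _ := by push_cast; nlinarith [Nat.cast_nonneg (α := ℝ) n]

/-! ### Anisotropic scaling along a unit vector -/

/-- The linear map scaling the direction of the unit vector `α` by `p` and its orthogonal
complement by `q`. -/
noncomputable def axialScaling {E : Type*} [NormedAddCommGroup E] [InnerProductSpace ℝ E] (α : E)
    (p q : ℝ) : E →ₗ[ℝ] E where
  toFun x := q • x + ((p - q) * inner ℝ α x) • α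
  map_add' x y := by
    rw [inner_add_right, smul_add, mul_add, add_smul]
    abel
  map_smul' c x := by
    rw [real_inner_smul_right, RingHom.id_apply, smul_add, smul_smul, smul_smul, smul_smul]
    congr 2 <;> ring

section axialScaling

variable {E : Type*} [NormedAddCommGroup E] [InnerProductSpace ℝ E] {α : E}

theorem axialScaling_apply (p q : ℝ) (x : E) :
    axialScaling α p q x = q • x + ((p - q) * inner ℝ α x) • α := rfl

theorem axialScaling_one_one (x : E) : axialScaling α 1 1 x = x := by
  simp [axialScaling_apply]

theorem inner_axialScaling_comm (p q : ℝ) (x y : E) :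
    inner ℝ (axialScaling α p q x) y = inner ℝ x (axialScaling α p q y) := by
  simp only [axialScaling_apply, inner_add_left, inner_add_right, real_inner_smul_left,
    real_inner_smul_right, real_inner_comm x α]
  ring

theorem inner_axialScaling (hα : ‖α‖ = 1) (p q : ℝ) (x : E) :
    inner ℝ α (axialScaling α p q x) = p * inner ℝ α x := by
  rw [axialScaling_apply, inner_add_right, real_inner_smul_right, real_inner_smul_right,
    real_inner_self_eq_norm_sq, hα]
  ring

theorem axialScaling_axialScaling (hα : ‖α‖ = 1) (p q p' q' : ℝ) (x : E) :
    axialScaling α p q (axialScaling α p' q' x) = axialScaling α (p * p') (q * q') x := by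
  rw [axialScaling_apply p q, inner_axialScaling hα, axialScaling_apply, axialScaling_apply,
    smul_add, smul_smul, smul_smul, add_assoc, ← add_smul]
  congr 2
  ring

theorem norm_axialScaling_sq (hα : ‖α‖ = 1) (p q : ℝ) (x : E) :
    ‖axialScaling α p q x‖ ^ 2
      = p ^ 2 * inner ℝ α x ^ 2 + q ^ 2 * ‖x - inner ℝ α x • α‖ ^ 2 := by
  have h1 : ‖x - inner ℝ α x • α‖ ^ 2 = ‖x‖ ^ 2 - inner ℝ α x ^ 2 := by
    rw [norm_sub_sq_real, real_inner_smul_right, norm_smul, hα, real_inner_comm, mul_one,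
      Real.norm_eq_abs, sq_abs]
    ring
  rw [h1, axialScaling_apply, norm_add_sq_real, norm_smul, norm_smul, real_inner_smul_left,
    real_inner_smul_right, hα, mul_one, real_inner_comm, mul_pow, Real.norm_eq_abs, sq_abs,
    Real.norm_eq_abs, sq_abs]
  ring

end axialScaling

/-! ### From covering to filling -/

namespace TorusFilling

theorem single_mem_intLattice {n : ℕ} (i : Fin n) :
    EuclideanSpace.single i (1 : ℝ) ∈ intLattice n := by
  intro j
  by_cases h : j = i
  · exact ⟨1, by simp [h]⟩
  · exact ⟨0, by simp [h]⟩

theorem span_intLattice (n : ℕ) :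
    Submodule.span ℝ (intLattice n : Set (EuclideanSpace ℝ (Fin n))) = ⊤ := by
  rw [eq_top_iff, ← (EuclideanSpace.basisFun (Fin n) ℝ).toBasis.span_eq, Submodule.span_le]
  rintro _ ⟨i, rfl⟩
  refine Submodule.subset_span ?_
  simpa using single_mem_intLattice i

/-- If no nonzero integer vector is simultaneously of size less than `a` along `α` and of norm less
than `2 * b`, then the flow in direction `α` fills the torus to within `n ^ 2 / (2 * b)` after
time `n ^ 2 / a`. -/
theorem fills_of_forall_intLattice {n : ℕ} {α : EuclideanSpace ℝ (Fin n)} (hα : ‖α‖ = 1)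
    {a b : ℝ} (ha : 0 < a) (hab : a ≤ b)
    (h : ∀ k ∈ intLattice n, k ≠ 0 → ‖k‖ < 2 * b → a ≤ |inner ℝ k α|) :
    Fills α (n ^ 2 / (2 * b)) (n ^ 2 / a) := by
  have hb : 0 < b := ha.trans_le hab
  let A := axialScaling α a b
  have hinv : ∀ x, A (axialScaling α a⁻¹ b⁻¹ x) = x := fun x => by
    rw [axialScaling_axialScaling hα, mul_inv_cancel₀ ha.ne', mul_inv_cancel₀ hb.ne',
      axialScaling_one_one]
  have hinv' : ∀ x, axialScaling α a⁻¹ b⁻¹ (A x) = x := fun x => by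
    rw [axialScaling_axialScaling hα, inv_mul_cancel₀ ha.ne', inv_mul_cancel₀ hb.ne',
      axialScaling_one_one]
  have hcover := ((intLattice n).map A.toAddMonoidHom).exists_norm_sub_le_of_forall_dual n
    (by simp) (by
      have h1 : (((intLattice n).map A.toAddMonoidHom : AddSubgroup _) :
        Set (EuclideanSpace ℝ (Fin n))) = A '' intLattice n := rfl
      rw [h1, Submodule.span_image, span_intLattice, Submodule.map_top, LinearMap.range_eq_top]
      exact fun x => ⟨_, hinv x⟩) (by
      intro y hy hint
      by_contra! hlt
      have hk : A y ∈ intLattice n := by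
        intro i
        obtain ⟨m, hm⟩ := hint _ ⟨_, single_mem_intLattice i, rfl⟩
        refine ⟨m, ?_⟩
        rw [← hm]
        change _ = inner ℝ (A _) y
        rw [inner_axialScaling_comm, EuclideanSpace.inner_single_left]
        simp [A]
      have hk0 : A y ≠ 0 := fun h0 => hy (by rw [← hinv' y, h0, map_zero])
      have hsq : ‖y‖ ^ 2 < 1 := by
        rw [← one_pow (n := 2)]
        gcongr
      have hnorm := norm_axialScaling_sq hα 1 1 y
      rw [axialScaling_one_one] at hnorm
      have hin : |inner ℝ (A y) α| < a := by
        rw [real_inner_comm, inner_axialScaling hα, abs_mul, abs_of_pos ha]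
        have : |inner ℝ α y| < 1 := by
          rw [← sq_lt_one_iff_abs_lt_one]
          nlinarith [sq_nonneg ‖y - inner ℝ α y • α‖]
        nlinarith
      refine absurd (h _ hk hk0 ?_) (not_le.2 hin)
      have h2 : ‖A y‖ ^ 2 ≤ b ^ 2 * ‖y‖ ^ 2 := by
        rw [norm_axialScaling_sq hα, hnorm]
        have : a ^ 2 * inner ℝ α y ^ 2 ≤ b ^ 2 * inner ℝ α y ^ 2 := by gcongr
        linarith
      -- In fact `‖A y‖ < b`; the factor 2 is slack.
      have h3 : ‖A y‖ ^ 2 < (2 * b) ^ 2 := by nlinarith [sq_pos_of_pos hb]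
      exact lt_of_pow_lt_pow_left₀ 2 (by positivity) h3)
  intro θ c
  obtain ⟨x, rfl⟩ := QuotientAddGroup.mk_surjective θ
  obtain ⟨z, rfl⟩ := QuotientAddGroup.mk_surjective c
  -- Shifting by half the total time centres the time error `s`, so that the hitting time lands in
  -- `[0, n ^ 2 / a]`.
  obtain ⟨_, ⟨k, hk, rfl⟩, hle⟩ := hcover (A (z - x - ((n : ℝ) ^ 2 / (2 * a)) • α))
  set w := z - x - ((n : ℝ) ^ 2 / (2 * a)) • α - k with hw
  have hle' : ‖A w‖ ≤ (n : ℝ) ^ 2 / 2 := by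
    rw [hw, map_sub]
    exact hle
  have hsq : ‖A w‖ ^ 2 ≤ ((n : ℝ) ^ 2 / 2) ^ 2 := by gcongr
  rw [norm_axialScaling_sq hα] at hsq
  set s : ℝ := inner ℝ α w with hs
  have hsa : |s| ≤ (n : ℝ) ^ 2 / (2 * a) := by
    have h1 : |a * s| ≤ (n : ℝ) ^ 2 / 2 := by
      refine abs_le_of_sq_le_sq ?_ (by positivity)
      nlinarith [sq_nonneg (b * ‖w - s • α‖)]
    rw [abs_mul, abs_of_pos ha] at h1
    rw [le_div_iff₀ (by positivity)]
    linarith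
  have hperp : ‖w - s • α‖ ≤ (n : ℝ) ^ 2 / (2 * b) := by
    have h1 : b * ‖w - s • α‖ ≤ (n : ℝ) ^ 2 / 2 := by
      refine (sq_le_sq₀ (by positivity) (by positivity)).1 ?_
      nlinarith [sq_nonneg (a * s)]
    rw [le_div_iff₀ (by positivity)]
    linarith
  have hT : (n : ℝ) ^ 2 / a = (n : ℝ) ^ 2 / (2 * a) + (n : ℝ) ^ 2 / (2 * a) := by
    field_simp
    norm_num
  obtain ⟨hs1, hs2⟩ := abs_le.1 hsa
  refine ⟨(n : ℝ) ^ 2 / (2 * a) + s, ⟨by linarith, by linarith⟩, ?_⟩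
  rw [Metric.mem_closedBall, dist_comm, dist_eq_norm_sub]
  have hrep : (QuotientAddGroup.mk z : Torus n)
      - linearFlow α ((n : ℝ) ^ 2 / (2 * a) + s) (QuotientAddGroup.mk x)
      = QuotientAddGroup.mk (w - s • α) := by
    rw [linearFlow, ← QuotientAddGroup.mk_add, ← QuotientAddGroup.mk_sub, QuotientAddGroup.eq]
    convert (intLattice n).neg_mem hk using 1
    rw [hw, add_smul]
    abel
  rw [hrep]
  exact (QuotientAddGroup.norm_mk_le_norm).trans hperp

end TorusFilling

/-! ### Choice of parameters -/

theorem corollary2 (n : ℕ) (hn : 2 ≤ n) (τ γ : ℝ) (hτ : (n : ℝ) - 1 < τ)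
    (hγ : γ ∈ Set.Ioo (0 : ℝ) 1) (hne : (TorusFilling.unitDiophantine n τ γ).Nonempty)
    (δ : ℝ) (hδ : δ ∈ Set.Ioo (0 : ℝ) (1 / 2))
    (N : ℝ) (hN : (1 + (n : ℝ) ^ 2 * (n.factorial : ℝ)) / δ ≤ N)
    (α : EuclideanSpace ℝ (Fin n)) (hα : α ∈ TorusFilling.unitTruncDiophantine n τ γ N) :
    ∃ T : ℝ, 0 ≤ T ∧
      T < (1 + (n : ℝ) ^ 2 * (n.factorial : ℝ)) ^ (τ + 1) / (γ * δ ^ τ) ∧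
      TorusFilling.Fills α δ T := by
  obtain ⟨hγ0, hγ1⟩ := hγ
  obtain ⟨hδ0, hδ1⟩ := hδ
  have hn2 : (2 : ℝ) ≤ n := by exact_mod_cast hn
  have hτ0 : 0 < τ := by linarith
  have hfact : (1 : ℝ) ≤ n.factorial := by exact_mod_cast n.factorial_pos
  have hC : (n : ℝ) ^ 2 < 1 + (n : ℝ) ^ 2 * n.factorial := by nlinarith [sq_nonneg (n : ℝ)]
  have hm : (0 : ℝ) < (n : ℝ) ^ 2 := by positivity
  have hα1 : ‖α‖ = 1 := by simpa using hα.1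
  have h2b : 2 * ((n : ℝ) ^ 2 / (2 * δ)) = (n : ℝ) ^ 2 / δ := by field_simp
  have hδτ : 0 < δ ^ τ := Real.rpow_pos_of_pos hδ0 τ
  -- With `b = n ^ 2 / (2 * δ)` the filling radius is exactly `δ`, and `a` is the Diophantine bound
  -- at norm `2 * b = n ^ 2 / δ`, which is at most `N`.
  have ha : 0 < γ * ((n : ℝ) ^ 2 / δ) ^ (-τ) := by positivity
  have hb1 : 1 ≤ (n : ℝ) ^ 2 / (2 * δ) := by
    rw [le_div_iff₀ (by positivity)]
    nlinarith
  have hfill := TorusFilling.fills_of_forall_intLattice hα1 ha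
    (b := (n : ℝ) ^ 2 / (2 * δ)) (by
      refine le_trans ?_ hb1
      refine mul_le_one₀ hγ1.le (by positivity) (Real.rpow_le_one_of_one_le_of_nonpos ?_
        (by linarith))
      rw [← h2b]
      linarith) (by
      intro k hk hk0 hlt
      rw [h2b] at hlt
      have hkpos : 0 < ‖k‖ := norm_pos_iff.2 hk0
      refine le_trans ?_ (hα.2 k hk hkpos (hlt.le.trans (le_trans ?_ hN)))
      · exact mul_le_mul_of_nonneg_left
          (Real.rpow_le_rpow_of_nonpos hkpos hlt.le (by linarith)) hγ0.le
      · gcongr)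
  have hT : (n : ℝ) ^ 2 / (γ * ((n : ℝ) ^ 2 / δ) ^ (-τ))
      = ((n : ℝ) ^ 2) ^ (τ + 1) / (γ * δ ^ τ) := by
    rw [Real.rpow_neg (by positivity), Real.div_rpow hm.le hδ0.le, Real.rpow_add hm,
      Real.rpow_one]
    field_simp
  have hδ' : (n : ℝ) ^ 2 / (2 * ((n : ℝ) ^ 2 / (2 * δ))) = δ := by field_simp
  rw [hT, hδ'] at hfill
  refine ⟨_, by positivity, ?_, hfill⟩
  -- The time found has `n ^ 2` in place of `1 + n ^ 2 * n!`, whence the strict inequality.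
  gcongr
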